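/- **Setting.** There are $n$ independent one-bit messages $x_1,\dots,x_n\in\{0,1\}$, $n$ receivers and $S$ senders. Sender $s$ knows the messages $x_i$ with $i\in M_s\subseteq V=\{1,\dots,n\}$, where $\bigcup_s M_s=V$. The requests are given by a directed graph $G$ on $V$ without self-loops: receiver $r$ knows $x_r$ and wants all $x_j$ with an arc $j\to r$ in $G$. The message graph $U$ is the undirected graph on $V$ in which distinct $i,j$ are adjacent if and only if $i,j\in M_s$ for some $s$. An index code consists of encoding functions $E_s:\{0,1\}^{M_s}\to\{0,1\}^{\ell_s}$, one for each sender, and decoding functions $D_r$, one for each receiver, such that for all values of the messages $D_r$ recovers $(x_j)_{j\to r}$ from all the codewords $E_1,\dots,E_S$ and $x_r$. Its length is $\sum_s\ell_s$. Let $\tilde\ell^*(G,U)$ be the minimum length of an index code for the given instance. **Definitions.** A leaf vertex is a vertex without outgoing arcs, and $V_{\mathrm{out}}(G)$ is the number of non-leaf vertices of $G$. A vertex $j$ is a predecessor of $i$ if there is a directed path from $j$ to $i$. A directed graph is grounded if each of its vertices is a leaf vertex or a predecessor of a leaf vertex. A leaf SCC is (the vertex set $C$ of) a strongly connected component with at least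 two vertices and with no arc from $C$ to a vertex outside $C$. A leaf SCC $C$ is - *message-connected* if any two vertices of $C$ are joined by a path in $U$ all of whose vertices lie in $C$; - *message-disconnected* if some two vertices of $C$ are not joined by any path in $U$; - *semi-message-connected* if it is neither. It is then *degenerated* if there are a non-empty proper subset $I\subsetneq C$ and a set $O$ of vertices outside $C$ such that (a) $U$ has no edge between $I$ and $C\setminus I$; (b) $O$ contains at most one non-leaf vertex; (c) every vertex outside $I$ that is adjacent in $U$ to a vertex of $I$ is in $O$ or is a predecessor in $G$ of a vertex in $O$. Otherwise it is *non-degenerated*. **Algorithm.** Starting from $(G,U)$, as long as the directed graph is not grounded, choose any leaf SCC $C$ of the current directed graph and modify the current pair of graphs as follows. - If $C$ is message-connected or non-degenerated, prune it: choose $v\in C$ and remove all outgoing arcs of $v$. - If $C$ is message-disconnected, append it: add a new vertex to both graphs (isolated in the undirected graph), choose $v\in C$, and add an arc from $v$ to the new vertex. - If $C$ is degenerated, append it: choose sets $I,O$ as above and $v\in I$, and add an arc from $v$ to the non-leaf vertex of $O$ if $O$ contains exactly one non-leaf vertex, and to an arbitrary vertex of $O$ if all vertices of $O$ are leaf vertices.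 All choices are arbitrary. Let $G^\dagger$ denote the directed graph obtained when the algorithm has stopped after finitely many steps, so that $G^\dagger$ is grounded. **Theorem (multi-sender lower bound).** For every such instance, the maximum of $V_{\mathrm{out}}(G^\dagger)$ over all finite sequences of steps (and all choices made in them) of the algorithm that end in a grounded graph $G^\dagger$ exists, and $$\tilde\ell^*(G,U)\ \ge\ \max V_{\mathrm{out}}(G^\dagger).$$ -/

import Mathlib

namespace IndexCoding

/-! ### Directed graphs -/

section Graph

variable {V : Type*}

/-- A leaf vertex has no outgoing arc. -/
def IsLeaf (G : Digraph V) (i : V) : Prop := ∀ j, ¬ G.Adj i j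

/-- The number of non-leaf vertices. -/
noncomputable def vOut (G : Digraph V) : ℕ := {i | ¬ IsLeaf G i}.ncard

/-- `j` is a predecessor of `i`: there is a directed path from `j` to `i`. -/
def IsPredecessor (G : Digraph V) (j i : V) : Prop := Relation.TransGen G.Adj j i

/-- Every vertex is a leaf vertex or a predecessor of some leaf vertex. -/
def IsGrounded (G : Digraph V) : Prop :=
  ∀ i, IsLeaf G i ∨ ∃ l, IsLeaf G l ∧ IsPredecessor G i l

/-- Any two vertices of `C` are joined, in both directions, by directed paths inside `C`. -/
def StronglyConnectedOn (G : Digraph V) (C : Set V) : Prop :=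
  ∀ i ∈ C, ∀ j ∈ C, Relation.ReflTransGen (fun a b => a ∈ C ∧ b ∈ C ∧ G.Adj a b) i j

/-- The vertex sets of the strongly connected components. -/
def IsSCC (G : Digraph V) (C : Set V) : Prop :=
  Maximal (fun D : Set V => D.Nonempty ∧ StronglyConnectedOn G D) C

/-- A leaf SCC: an SCC with at least two vertices and no arc leaving it. -/
def IsLeafSCC (G : Digraph V) (C : Set V) : Prop :=
  IsSCC G C ∧ C.Nontrivial ∧ ∀ i ∈ C, ∀ j, G.Adj i j → j ∈ C

/-! ### Types of leaf SCCs, relative to the message graph `U` -/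

/-- Any two vertices of `C` are joined by a path of `U` inside `C`. -/
def MessageConnected (U : SimpleGraph V) (C : Set V) : Prop := (U.induce C).Preconnected

/-- Some two vertices of `C` are not joined by any path of `U`. -/
def MessageDisconnected (U : SimpleGraph V) (C : Set V) : Prop :=
  ∃ i ∈ C, ∃ j ∈ C, ¬ U.Reachable i j

def SemiMessageConnected (U : SimpleGraph V) (C : Set V) : Prop :=
  ¬ MessageConnected U C ∧ ¬ MessageDisconnected U C

/-- The pair of vertex sets (`I` inside `C`, `O` outside `C`) witnesses that `C` is degenerated. -/
structure IsDegeneration (G : Digraph V) (U : SimpleGraph V) (C I O : Set V) : Prop where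
  inside_nonempty : I.Nonempty
  inside_ssubset : I ⊂ C
  outside_subset : O ⊆ Cᶜ
  no_edge : ∀ a ∈ I, ∀ b ∈ C \ I, ¬ U.Adj a b
  nonLeaf_subsingleton : {o ∈ O | ¬ IsLeaf G o}.Subsingleton
  neighbor : ∀ i, i ∉ I → (∃ v ∈ I, U.Adj i v) → i ∈ O ∨ ∃ o ∈ O, IsPredecessor G i o

def Degenerated (G : Digraph V) (U : SimpleGraph V) (C : Set V) : Prop :=
  SemiMessageConnected U C ∧ ∃ I O, IsDegeneration G U C I O

def NonDegenerated (G : Digraph V) (U : SimpleGraph V) (C : Set V) : Prop :=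
  SemiMessageConnected U C ∧ ¬ ∃ I O, IsDegeneration G U C I O

/-! ### Modifications of the graphs -/

/-- Remove all outgoing arcs of `v`. -/
def pruneAt (G : Digraph V) (v : V) : Digraph V where
  Adj i j := G.Adj i j ∧ i ≠ v

/-- Add the arc `v → w`. -/
def addArc (G : Digraph V) (v w : V) : Digraph V where
  Adj i j := G.Adj i j ∨ (i = v ∧ j = w)

end Graph

/-- Add a new vertex (the last one) and the arc from `v` to it. -/
def appendDummy {n : ℕ} (G : Digraph (Fin n)) (v : Fin n) : Digraph (Fin (n + 1)) where
  Adj i j := (∃ a b, G.Adj a b ∧ a.castSucc = i ∧ b.castSucc = j) ∨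
    (i = v.castSucc ∧ j = Fin.last n)

/-! ### The prune/append algorithm -/

/-- What the algorithm works on: a directed graph and an undirected graph on the same
finite vertex set. -/
structure State where
  n : ℕ
  G : Digraph (Fin n)
  U : SimpleGraph (Fin n)

/-- One iteration: select a leaf SCC `C`, and prune it or append it according to its type. -/
inductive Step : State → State → Prop
  | prune {n : ℕ} (G : Digraph (Fin n)) (U : SimpleGraph (Fin n)) (C : Set (Fin n))
      (hC : IsLeafSCC G C) (hU : MessageConnected U C ∨ NonDegenerated G U C)
      (v : Fin n) (hv : v ∈ C) :
      Step ⟨n, G, U⟩ ⟨n, pruneAt G v, U⟩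
  | appendDisconnected {n : ℕ} (G : Digraph (Fin n)) (U : SimpleGraph (Fin n)) (C : Set (Fin n))
      (hC : IsLeafSCC G C) (hU : MessageDisconnected U C)
      (v : Fin n) (hv : v ∈ C) :
      Step ⟨n, G, U⟩ ⟨n + 1, appendDummy G v, U.map Fin.castSucc⟩
  /-- The outside set `O` contains exactly one non-leaf vertex, `w`. -/
  | appendDegeneratedNonLeaf {n : ℕ} (G : Digraph (Fin n)) (U : SimpleGraph (Fin n))
      (C I O : Set (Fin n)) (hC : IsLeafSCC G C) (hU : SemiMessageConnected U C)
      (hdeg : IsDegeneration G U C I O)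
      (v : Fin n) (hv : v ∈ I) (w : Fin n) (hw : w ∈ O) (hwl : ¬ IsLeaf G w) :
      Step ⟨n, G, U⟩ ⟨n, addArc G v w, U⟩
  /-- All vertices of the outside set `O` are leaf vertices. -/
  | appendDegeneratedLeaf {n : ℕ} (G : Digraph (Fin n)) (U : SimpleGraph (Fin n))
      (C I O : Set (Fin n)) (hC : IsLeafSCC G C) (hU : SemiMessageConnected U C)
      (hdeg : IsDegeneration G U C I O) (hO : ∀ o ∈ O, IsLeaf G o)
      (v : Fin n) (hv : v ∈ I) (w : Fin n) (hw : w ∈ O) :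
      Step ⟨n, G, U⟩ ⟨n, addArc G v w, U⟩

/-- `T` is a possible result of running the algorithm on `A`: it is reached by finitely many
iterations, and its directed graph is grounded. -/
def IsResult (A T : State) : Prop := Relation.ReflTransGen Step A T ∧ IsGrounded T.G

/-! ### Multi-sender single-uniprior index coding with one-bit messages -/

section Code

variable {n S : ℕ}

/-- The message graph of the sender setting `M`, where sender `s` knows the messages in `M s`. -/
def messageGraph (M : Fin S → Set (Fin n)) : SimpleGraph (Fin n) where
  Adj i j := i ≠ j ∧ ∃ s, i ∈ M s ∧ j ∈ M s
  symm := ⟨fun _ _ h => ⟨h.1.symm, h.2.imp fun _ hs => hs.symm⟩⟩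
  loopless := ⟨fun _ h => h.1 rfl⟩

/-- A multi-sender index code: receiver `r` knows the bit `x r` and wants the bits `x j` with
`j → r` in `G`. -/
structure IndexCode (G : Digraph (Fin n)) (M : Fin S → Set (Fin n)) where
  len : Fin S → ℕ
  enc : ∀ s, (M s → Bool) → (Fin (len s) → Bool)
  dec : ∀ r : Fin n, (∀ s, Fin (len s) → Bool) → Bool → ({j // G.Adj j r} → Bool)
  correct : ∀ (x : Fin n → Bool) (r : Fin n),
    dec r (fun s => enc s (fun i => x i.1)) (x r) = fun j => x j.1

/-- The total number of transmitted bits. -/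
def IndexCode.codelength {G : Digraph (Fin n)} {M : Fin S → Set (Fin n)}
    (c : IndexCode G M) : ℕ := ∑ s, c.len s

/-- The optimal (minimum) index codelength. -/
noncomputable def optimalCodelength (G : Digraph (Fin n)) (M : Fin S → Set (Fin n)) : ℕ :=
  sInf {l | ∃ c : IndexCode G M, c.codelength = l}

open Classical in
/-- If every message is known to some sender then the minimum is attained. -/
theorem exists_codelength_eq_optimal (G : Digraph (Fin n)) (M : Fin S → Set (Fin n))
    (hM : ∀ i, ∃ s, i ∈ M s) : ∃ c : IndexCode G M, c.codelength = optimalCodelength G M := by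
  have hne : {l | ∃ c : IndexCode G M, c.codelength = l}.Nonempty := by
    choose f hf using hM
    refine ⟨_, ⟨fun _ => n, fun s y i => if h : i ∈ M s then y ⟨i, h⟩ else false,
      fun r y _ j => y (f j.1) j.1, ?_⟩, rfl⟩
    intro x r
    funext j
    simp [hf]
  exact Nat.sInf_mem hne

end Code

end IndexCoding

/-! Let a genie reveal the messages of all leaf vertices. The invariant `IsGenieCode` says that,
given the codewords and these free messages, knowing the message at `j` determines the message at
`i` for every arc `i → j`. A correct index code has this property, and every step keeps it with the
same codeword lengths (`HasGenieCode.step`). In a grounded graph, every message is then determined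
by walking back along arcs from leaves, so the non-leaf messages inject into the codewords and
`vOut` is at most the total length (`vOut_le`).

Pruning only removes constraints and creates free messages. Appending needs the new arc to be
justified. Inside a leaf SCC, agreement of two indistinguishable inputs at one vertex spreads to all
vertices. Splicing the two inputs along a cut that no sender can detect gives a third
indistinguishable input, which forces agreement (`eq_of_messageDisconnected`,
`eq_of_isDegeneration`).

For the maximum to exist, some run must also end; this follows from a lexicographic measure. -/

namespace IndexCoding

open Relation

/-! ### Reachability of leaves and its behaviour under the graph modifications. -/

section Reachability

variable {V : Type*}

/-- Some leaf vertex can be reached from `i`. -/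
def ReachesLeaf (G : Digraph V) (i : V) : Prop := ∃ l, IsLeaf G l ∧ ReflTransGen G.Adj i l

theorem reachesLeaf_iff {G : Digraph V} {i : V} :
    ReachesLeaf G i ↔ IsLeaf G i ∨ ∃ l, IsLeaf G l ∧ IsPredecessor G i l := by
  constructor
  · rintro ⟨l, hl, h⟩
    rcases reflTransGen_iff_eq_or_transGen.1 h with rfl | h
    · exact .inl hl
    · exact .inr ⟨l, hl, h⟩
  · rintro (h | ⟨l, hl, h⟩)
    · exact ⟨i, h, .refl⟩
    · exact ⟨l, hl, h.to_reflTransGen⟩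

theorem isGrounded_iff {G : Digraph V} : IsGrounded G ↔ ∀ i, ReachesLeaf G i :=
  forall_congr' fun _ => reachesLeaf_iff.symm

theorem ReachesLeaf.of_reflTransGen {G : Digraph V} {i j : V} (h : ReflTransGen G.Adj i j)
    (hj : ReachesLeaf G j) : ReachesLeaf G i :=
  hj.imp fun _ hl => ⟨hl.1, h.trans hl.2⟩

namespace IsLeafSCC

variable {G : Digraph V} {C : Set V}

theorem reflTransGen (hC : IsLeafSCC G C) {i j : V} (hi : i ∈ C) (hj : j ∈ C) :
    ReflTransGen G.Adj i j :=
  ReflTransGen.mono (fun _ _ h => h.2.2) _ _ (hC.1.prop.2 i hi j hj)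

theorem mem_of_reflTransGen (hC : IsLeafSCC G C) {i j : V} (hi : i ∈ C)
    (h : ReflTransGen G.Adj i j) : j ∈ C := by
  induction h with
  | refl => exact hi
  | tail _ hab ih => exact hC.2.2 _ ih _ hab

theorem not_isLeaf (hC : IsLeafSCC G C) {i : V} (hi : i ∈ C) : ¬ IsLeaf G i := by
  obtain ⟨j, hj, hne⟩ := hC.2.1.exists_ne i
  rcases (hC.reflTransGen hi hj).cases_head with h | ⟨k, hk, -⟩
  · exact absurd h.symm hne
  · exact fun hl => hl k hk

theorem not_reachesLeaf (hC : IsLeafSCC G C) {i : V} (hi : i ∈ C) : ¬ ReachesLeaf G i :=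
  fun ⟨_, hl, h⟩ => hC.not_isLeaf (hC.mem_of_reflTransGen hi h) hl

end IsLeafSCC

/-- A finite loopless directed graph that is not grounded has a leaf SCC. -/
theorem exists_isLeafSCC [Finite V] {G : Digraph V} (hG : ∀ i, ¬ G.Adj i i)
    (h : ¬ IsGrounded G) : ∃ C, IsLeafSCC G C := by
  have hne : {i | ¬ ReachesLeaf G i}.Nonempty := by
    simpa [isGrounded_iff, Set.Nonempty] using h
  -- An ungrounded vertex with the smallest reachable set: everything it reaches is also ungrounded,
  -- so by minimality reaches it back, and the reachable set is a leaf SCC.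
  obtain ⟨i, hi, hmin⟩ := Set.exists_min_image {i | ¬ ReachesLeaf G i}
    (fun i => {j | ReflTransGen G.Adj i j}.ncard) (Set.toFinite _) hne
  have hback : ∀ j, ReflTransGen G.Adj i j → ReflTransGen G.Adj j i := by
    intro j hj
    have hsub : {k | ReflTransGen G.Adj j k} ⊆ {k | ReflTransGen G.Adj i k} :=
      fun k hk => hj.trans hk
    have heq := Set.eq_of_subset_of_ncard_le hsub
      (hmin j fun hl => hi (hl.of_reflTransGen hj)) (Set.toFinite _)
    have : i ∈ {k | ReflTransGen G.Adj i k} := ReflTransGen.refl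
    rwa [← heq] at this
  refine ⟨{j | ReflTransGen G.Adj i j}, ⟨⟨⟨i, .refl⟩, ?_⟩, ?_⟩, ?_, ?_⟩
  · intro a ha b hb
    have hab : ReflTransGen G.Adj a b := (hback a ha).trans hb
    clear hb
    induction hab with
    | refl => exact .refl
    | @tail c d hac hcd ih =>
      have hc : ReflTransGen G.Adj i c := ReflTransGen.trans ha hac
      exact ih.tail ⟨hc, hc.tail hcd, hcd⟩
  · rintro D ⟨-, hD⟩ hle d hd
    exact ReflTransGen.mono (fun _ _ h => h.2.2) _ _ (hD i (hle ReflTransGen.refl) d hd)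
  · have hl : ¬ IsLeaf G i := fun hl => hi ⟨i, hl, .refl⟩
    obtain ⟨k, hk⟩ : ∃ k, G.Adj i k := by simpa [IsLeaf] using hl
    exact ⟨i, .refl, k, .single hk, fun e => hG i (by rwa [← e] at hk)⟩
  · exact fun a ha b hab => ReflTransGen.tail ha hab

/-- A path to a leaf either avoids `v` and survives, or meets `v`, which has become a leaf. -/
theorem ReachesLeaf.pruneAt {G : Digraph V} {i : V} (v : V) (h : ReachesLeaf G i) :
    ReachesLeaf (pruneAt G v) i := by
  obtain ⟨l, hl, h⟩ := h
  induction h using ReflTransGen.head_induction_on with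
  | refl => exact ⟨l, fun j hj => hl j hj.1, .refl⟩
  | @head a b hab _ ih =>
    by_cases hav : a = v
    · exact ⟨a, fun j hj => hj.2 hav, .refl⟩
    · exact ih.of_reflTransGen (.single ⟨hab, hav⟩)

theorem isLeaf_addArc {G : Digraph V} {v : V} (w : V) (hv : ¬ IsLeaf G v) {l : V} :
    IsLeaf (addArc G v w) l ↔ IsLeaf G l := by
  refine ⟨fun h j hj => h j (.inl hj), fun h j hj => ?_⟩
  rcases hj with hj | ⟨rfl, -⟩
  · exact h j hj
  · exact hv h

theorem reflTransGen_addArc {G : Digraph V} {i j : V} (v w : V) (h : ReflTransGen G.Adj i j) :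
    ReflTransGen (addArc G v w).Adj i j :=
  ReflTransGen.mono (fun _ _ => .inl) _ _ h

theorem ReachesLeaf.addArc {G : Digraph V} {i v : V} (w : V) (hv : ¬ IsLeaf G v)
    (h : ReachesLeaf G i) : ReachesLeaf (addArc G v w) i :=
  h.imp fun _ hl => ⟨(isLeaf_addArc w hv).2 hl.1, reflTransGen_addArc v w hl.2⟩

theorem isLeaf_appendDummy_castSucc {n : ℕ} {G : Digraph (Fin n)} {v l : Fin n}
    (hv : ¬ IsLeaf G v) (hl : IsLeaf G l) : IsLeaf (appendDummy G v) l.castSucc := by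
  rintro j (⟨a, b, hab, ha, -⟩ | ⟨h, -⟩)
  · rw [Fin.castSucc_inj] at ha
    exact hl b (ha ▸ hab)
  · rw [Fin.castSucc_inj] at h
    exact hv (h ▸ hl)

theorem isLeaf_appendDummy_last {n : ℕ} (G : Digraph (Fin n)) (v : Fin n) :
    IsLeaf (appendDummy G v) (Fin.last n) := by
  rintro j (⟨a, b, -, ha, -⟩ | ⟨h, -⟩)
  · exact Fin.castSucc_ne_last a ha
  · exact Fin.castSucc_ne_last v h.symm

theorem ReachesLeaf.appendDummy {n : ℕ} {G : Digraph (Fin n)} {v i : Fin n}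
    (hv : ¬ IsLeaf G v) (h : ReachesLeaf G i) : ReachesLeaf (appendDummy G v) i.castSucc := by
  obtain ⟨l, hl, h⟩ := h
  exact ⟨l.castSucc, isLeaf_appendDummy_castSucc hv hl,
    h.lift Fin.castSucc fun a b hab => .inl ⟨a, b, hab, rfl, rfl⟩⟩

end Reachability

/-! ### Termination of the algorithm. -/

section Termination

/-- The number of vertices from which no leaf vertex can be reached. -/
noncomputable def ungroundedCount (A : State) : ℕ := {i | ¬ ReachesLeaf A.G i}.ncard

/-- The number of pairs of vertices not joined by a directed path. -/
noncomputable def unreachableCount (A : State) : ℕ :=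
  {p : Fin A.n × Fin A.n | ¬ ReflTransGen A.G.Adj p.1 p.2}.ncard

/-- Pruning and appending a new vertex lower the first count. An arc added to an existing vertex may
leave it unchanged, since its head may be ungrounded too; the second count covers this case. -/
def Decreases (B A : State) : Prop :=
  ungroundedCount B < ungroundedCount A ∨
    ungroundedCount B ≤ ungroundedCount A ∧ unreachableCount B < unreachableCount A

theorem decreases_pruneAt {n : ℕ} {G : Digraph (Fin n)} {C : Set (Fin n)}
    (U : SimpleGraph (Fin n)) (hC : IsLeafSCC G C) {v : Fin n} (hv : v ∈ C) :
    Decreases ⟨n, pruneAt G v, U⟩ ⟨n, G, U⟩ := by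
  refine .inl (Set.ncard_lt_ncard ?_ (Set.toFinite _))
  have hsub : {i | ¬ ReachesLeaf (pruneAt G v) i} ⊆ {i | ¬ ReachesLeaf G i} :=
    fun i hi h => hi (h.pruneAt v)
  exact (Set.ssubset_iff_of_subset hsub).2
    ⟨v, hC.not_reachesLeaf hv, not_not.2 ⟨v, fun j hj => hj.2 rfl, .refl⟩⟩

theorem decreases_appendDummy {n : ℕ} {G : Digraph (Fin n)} {C : Set (Fin n)}
    (U : SimpleGraph (Fin n)) (hC : IsLeafSCC G C) {v : Fin n} (hv : v ∈ C) :
    Decreases ⟨n + 1, appendDummy G v, U.map Fin.castSucc⟩ ⟨n, G, U⟩ := by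
  left
  have hlast := isLeaf_appendDummy_last G v
  have hss : {i | ¬ ReachesLeaf (appendDummy G v) i} ⊂
      Fin.castSucc '' {i | ¬ ReachesLeaf G i} := by
    refine (Set.ssubset_iff_of_subset ?_).2 ⟨v.castSucc, ⟨v, hC.not_reachesLeaf hv, rfl⟩,
      not_not.2 ⟨Fin.last n, hlast, .single (.inr ⟨rfl, rfl⟩)⟩⟩
    intro i hi
    induction i using Fin.lastCases with
    | last => exact absurd ⟨_, hlast, .refl⟩ hi
    | cast i => exact ⟨i, fun h => hi (h.appendDummy (hC.not_isLeaf hv)), rfl⟩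
  calc _ < (Fin.castSucc '' {i | ¬ ReachesLeaf G i}).ncard :=
        Set.ncard_lt_ncard hss (Set.toFinite _)
    _ = _ := Set.ncard_image_of_injective _ (Fin.castSucc_injective n)

/-- No path leaves `C`, so `w` was unreachable from `v`; the new arc joins this pair and separates
none. -/
theorem decreases_addArc {n : ℕ} {G : Digraph (Fin n)} {C : Set (Fin n)}
    (U : SimpleGraph (Fin n)) (hC : IsLeafSCC G C) {v w : Fin n} (hv : v ∈ C) (hw : w ∉ C) :
    Decreases ⟨n, addArc G v w, U⟩ ⟨n, G, U⟩ := by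
  refine .inr ⟨Set.ncard_le_ncard (fun i hi h => hi (h.addArc w (hC.not_isLeaf hv)))
    (Set.toFinite _), Set.ncard_lt_ncard ?_ (Set.toFinite _)⟩
  have hsub : {p : Fin n × Fin n | ¬ ReflTransGen (addArc G v w).Adj p.1 p.2} ⊆
      {p | ¬ ReflTransGen G.Adj p.1 p.2} := fun p hp h => hp (reflTransGen_addArc v w h)
  exact (Set.ssubset_iff_of_subset hsub).2
    ⟨(v, w), fun h => hw (hC.mem_of_reflTransGen hv h),
      not_not.2 (ReflTransGen.single (.inr ⟨rfl, rfl⟩))⟩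

/-- With `O` empty, condition (c) makes `I` closed under adjacency in `U`, although some path of `U`
joins `I` to `C \ I`. The lemma supplies a head for the new arc. -/
theorem IsDegeneration.outside_nonempty {V : Type*} {G : Digraph V} {U : SimpleGraph V}
    {C I O : Set V} (h : IsDegeneration G U C I O) (hU : SemiMessageConnected U C) :
    O.Nonempty := by
  by_contra hO
  rw [Set.not_nonempty_iff_eq_empty] at hO
  obtain ⟨a, ha⟩ := h.inside_nonempty
  obtain ⟨b, hb, hbI⟩ := Set.exists_of_ssubset h.inside_ssubset
  have hab : U.Reachable a b := by
    by_contra hab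
    exact hU.2 ⟨a, h.inside_ssubset.1 ha, b, hb, hab⟩
  refine hbI ?_
  rw [SimpleGraph.reachable_iff_reflTransGen] at hab
  clear hb hbI
  induction hab with
  | refl => exact ha
  | @tail c d _ hcd ih =>
    by_contra hd
    simpa [hO] using h.neighbor d hd ⟨c, ih, hcd.symm⟩

theorem exists_step_decreases {A : State} (hA : ∀ i, ¬ A.G.Adj i i) (h : ¬ IsGrounded A.G) :
    ∃ B, Step A B ∧ (∀ i, ¬ B.G.Adj i i) ∧ Decreases B A := by
  obtain ⟨n, G, U⟩ := A
  obtain ⟨C, hC⟩ := exists_isLeafSCC hA h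
  obtain ⟨v, hv⟩ := hC.1.prop.1
  by_cases hprune : MessageConnected U C ∨ NonDegenerated G U C
  · exact ⟨_, .prune G U C hC hprune v hv, fun i hi => hA i hi.1, decreases_pruneAt U hC hv⟩
  by_cases hdis : MessageDisconnected U C
  · refine ⟨_, .appendDisconnected G U C hC hdis v hv, ?_, decreases_appendDummy U hC hv⟩
    rintro i (⟨a, b, hab, rfl, hb⟩ | ⟨rfl, h⟩)
    · rw [Fin.castSucc_inj] at hb
      exact hA a (hb ▸ hab)
    · exact Fin.castSucc_ne_last v h
  have hU : SemiMessageConnected U C := ⟨fun h => hprune (.inl h), hdis⟩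
  have hex : ∃ I O, IsDegeneration G U C I O := by
    by_contra hnot
    exact hprune (.inr ⟨hU, hnot⟩)
  obtain ⟨I, O, hdeg⟩ := hex
  obtain ⟨u, hu⟩ := hdeg.inside_nonempty
  have huC := hdeg.inside_ssubset.1 hu
  have hstep : ∃ w ∈ O, Step ⟨n, G, U⟩ ⟨n, addArc G u w, U⟩ := by
    by_cases hO : ∀ o ∈ O, IsLeaf G o
    · obtain ⟨w, hw⟩ := hdeg.outside_nonempty hU
      exact ⟨w, hw, .appendDegeneratedLeaf G U C I O hC hU hdeg hO u hu w hw⟩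
    · push Not at hO
      obtain ⟨w, hw, hwl⟩ := hO
      exact ⟨w, hw, .appendDegeneratedNonLeaf G U C I O hC hU hdeg u hu w hw hwl⟩
  obtain ⟨w, hw, hs⟩ := hstep
  have hwC : w ∉ C := hdeg.outside_subset hw
  refine ⟨_, hs, ?_, decreases_addArc U hC huC hwC⟩
  rintro i (hi | ⟨hiu, hiw⟩)
  · exact hA i hi
  · exact hwC (hiw ▸ hiu ▸ huC)

theorem wellFounded_decreases : WellFounded Decreases := by
  refine Subrelation.wf (r := InvImage (Prod.Lex (· < ·) (· < ·))
    fun A => (ungroundedCount A, unreachableCount A)) ?_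
    (InvImage.wf _ (wellFounded_lt.prod_lex wellFounded_lt))
  rintro B A (h | ⟨h, h'⟩)
  · exact .left _ _ h
  · rcases h.lt_or_eq with h | h
    · exact .left _ _ h
    · change Prod.Lex _ _ (_, _) (_, _)
      rw [h]
      exact .right _ h'

/-- The algorithm can be run to its end. -/
theorem exists_isResult (A : State) (hA : ∀ i, ¬ A.G.Adj i i) : ∃ T, IsResult A T := by
  revert hA
  refine wellFounded_decreases.induction (C := fun A => (∀ i, ¬ A.G.Adj i i) → ∃ T, IsResult A T)
    A fun A ih hA => ?_
  by_cases h : IsGrounded A.G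
  · exact ⟨A, .refl, h⟩
  · obtain ⟨B, hAB, hB, hlt⟩ := exists_step_decreases hA h
    obtain ⟨T, hT, hg⟩ := ih B hlt hB
    exact ⟨T, hT.head hAB, hg⟩

end Termination

/-! ### The genie-code invariant and the counting bound. -/

section LowerBound

variable {S : ℕ}

/-- The codewords and the messages of the leaf vertices agree under `x` and `y`. -/
def Indistinguishable {n : ℕ} {len : Fin S → ℕ} (G : Digraph (Fin n))
    (f : ∀ s, (Fin n → Bool) → Fin (len s) → Bool) (x y : Fin n → Bool) : Prop :=
  (∀ s, f s x = f s y) ∧ ∀ l, IsLeaf G l → x l = y l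

/-- Codewords `f`, one for each sender and each depending on messages that are pairwise adjacent
in `U`, such that for every arc `i → j` the message of `i` is determined by the codewords,
the messages of the leaf vertices and the message of `j`. -/
structure IsGenieCode {n : ℕ} {len : Fin S → ℕ} (G : Digraph (Fin n)) (U : SimpleGraph (Fin n))
    (M : Fin S → Set (Fin n)) (f : ∀ s, (Fin n → Bool) → Fin (len s) → Bool) : Prop where
  clique : ∀ s, ∀ i ∈ M s, ∀ j ∈ M s, i ≠ j → U.Adj i j
  congr : ∀ s x y, (∀ i ∈ M s, x i = y i) → f s x = f s y
  arc : ∀ i j, G.Adj i j → ∀ x y, Indistinguishable G f x y → x j = y j → x i = y i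

namespace IsGenieCode

variable {n : ℕ} {len : Fin S → ℕ} {G : Digraph (Fin n)} {U : SimpleGraph (Fin n)}
  {M : Fin S → Set (Fin n)} {f : ∀ s, (Fin n → Bool) → Fin (len s) → Bool}
  {C : Set (Fin n)} {x y : Fin n → Bool}

theorem eq_of_reflTransGen (h : IsGenieCode G U M f) (hxy : Indistinguishable G f x y)
    {i j : Fin n} (hij : ReflTransGen G.Adj i j) (hj : x j = y j) : x i = y i := by
  induction hij using ReflTransGen.head_induction_on with
  | refl => exact hj
  | head hab _ ih => exact h.arc _ _ hab x y hxy ih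

theorem eq_of_messageDisconnected (h : IsGenieCode G U M f) (hC : IsLeafSCC G C)
    (hU : MessageDisconnected U C) (hxy : Indistinguishable G f x y) {v : Fin n} (hv : v ∈ C) :
    x v = y v := by
  classical
  obtain ⟨i, hi, j, hj, hij⟩ := hU
  -- The hybrid input: `x` on the `U`-component of `i`, `y` elsewhere. The messages of a sender form
  -- a clique, hence lie on one side, so no codeword changes. Agreement of `x` and `z` at `i`
  -- spreads to `j`, where `z` is `y`.
  let z : Fin n → Bool := fun k => if U.Reachable i k then x k else y k
  have hz : Indistinguishable G f x z := by
    constructor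
    · intro s
      by_cases hs : ∃ k ∈ M s, U.Reachable i k
      · obtain ⟨k, hk, hik⟩ := hs
        refine h.congr s x z fun k' hk' => ?_
        have : U.Reachable i k' := by
          by_cases e : k = k'
          · exact e ▸ hik
          · exact hik.trans (h.clique s k hk k' hk' e).reachable
        simp [z, this]
      · push Not at hs
        rw [hxy.1 s]
        exact h.congr s y z fun k hk => by simp [z, hs k hk]
    · intro l hl
      simp [z, hxy.2 l hl]
  have hji : x j = z j :=
    h.eq_of_reflTransGen hz (hC.reflTransGen hj hi) (by simp [z])
  refine h.eq_of_reflTransGen hxy (hC.reflTransGen hv hj) ?_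
  simpa [z, hij] using hji

theorem eq_of_isDegeneration {I O : Set (Fin n)} (h : IsGenieCode G U M f) (hC : IsLeafSCC G C)
    (hdeg : IsDegeneration G U C I O) (hxy : Indistinguishable G f x y)
    (hO : ∀ o ∈ O, x o = y o) {v : Fin n} (hv : v ∈ I) : x v = y v := by
  classical
  have hnb : ∀ k, k ∉ I → (∃ a ∈ I, U.Adj k a) → x k = y k := by
    intro k hk hadj
    rcases hdeg.neighbor k hk hadj with hkO | ⟨o, ho, hko⟩
    · exact hO k hkO
    · exact h.eq_of_reflTransGen hxy hko.to_reflTransGen (hO o ho)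
  -- The hybrid takes `y` on `I` and `x` elsewhere. A sender with a message in `I` sees `y`, because
  -- `x` and `y` agree on the neighbours of `I` by `hnb`; any other sender sees `x`. Agreement of
  -- `x` and `z` on `C \ I` then spreads to `v`.
  let z : Fin n → Bool := fun k => if k ∈ I then y k else x k
  have hz : Indistinguishable G f x z := by
    constructor
    · intro s
      by_cases hs : ∃ a ∈ M s, a ∈ I
      · obtain ⟨a, ha, haI⟩ := hs
        rw [hxy.1 s]
        refine h.congr s y z fun k hk => ?_
        by_cases hkI : k ∈ I
        · simp [z, hkI]
        · have hka : k ≠ a := fun e => hkI (e ▸ haI)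
          simp [z, hkI, hnb k hkI ⟨a, haI, h.clique s k hk a ha hka⟩]
      · push Not at hs
        exact h.congr s x z fun k hk => by simp [z, hs k hk]
    · intro l hl
      simp [z, hxy.2 l hl]
  obtain ⟨j, hj, hjI⟩ := Set.exists_of_ssubset hdeg.inside_ssubset
  have := h.eq_of_reflTransGen hz (hC.reflTransGen (hdeg.inside_ssubset.1 hv) hj)
    (by simp [z, hjI])
  simpa [z, hv] using this

/-- Old leaves remain leaves, so indistinguishability in the pruned graph is the stronger condition,
and no arc is new. -/
theorem pruneAt (h : IsGenieCode G U M f) (v : Fin n) :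
    IsGenieCode (pruneAt G v) U M f :=
  ⟨h.clique, h.congr, fun i j hij x y hxy =>
    h.arc i j hij.1 x y ⟨hxy.1, fun l hl => hxy.2 l fun k hk => hl k hk.1⟩⟩

/-- The new vertex carries a message that no sender holds, so its arc asks that `v` be determined
without further help. As `v` was not a leaf, no old leaf message ceases to be free. -/
theorem appendDummy (h : IsGenieCode G U M f) (hC : IsLeafSCC G C)
    (hU : MessageDisconnected U C) {v : Fin n} (hv : v ∈ C) :
    IsGenieCode (appendDummy G v) (U.map Fin.castSucc) (fun s => Fin.castSucc '' M s)
      (fun s x => f s (x ∘ Fin.castSucc)) := by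
  refine ⟨?_, fun s x y hxy => h.congr s _ _ fun i hi => hxy _ ⟨i, hi, rfl⟩, ?_⟩
  · rintro s _ ⟨i, hi, rfl⟩ _ ⟨j, hj, rfl⟩ hij
    have hne : i ≠ j := fun e => hij (e ▸ rfl)
    exact ⟨hij, i, j, h.clique s i hi j hj hne, rfl, rfl⟩
  · intro i j hij x y hxy hj
    have hxy' : Indistinguishable G f (x ∘ Fin.castSucc) (y ∘ Fin.castSucc) :=
      ⟨hxy.1, fun l hl => hxy.2 _ (isLeaf_appendDummy_castSucc (hC.not_isLeaf hv) hl)⟩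
    rcases hij with ⟨a, b, hab, rfl, rfl⟩ | ⟨rfl, rfl⟩
    · exact h.arc a b hab _ _ hxy' hj
    · exact h.eq_of_messageDisconnected hC hU hxy' hv

/-- The hypothesis `hO` covers both degenerated append rules: messages in `O` are free except
possibly that of `w`, which is given when decoding along `v → w`. -/
theorem addArc {I O : Set (Fin n)} (h : IsGenieCode G U M f) (hC : IsLeafSCC G C)
    (hdeg : IsDegeneration G U C I O) {v w : Fin n} (hv : v ∈ I)
    (hO : ∀ o ∈ O, IsLeaf G o ∨ o = w) : IsGenieCode (addArc G v w) U M f := by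
  refine ⟨h.clique, h.congr, fun i j hij x y hxy hj => ?_⟩
  have hvl := hC.not_isLeaf (hdeg.inside_ssubset.1 hv)
  have hxy' : Indistinguishable G f x y :=
    ⟨hxy.1, fun l hl => hxy.2 l ((isLeaf_addArc w hvl).2 hl)⟩
  rcases hij with hij | ⟨rfl, rfl⟩
  · exact h.arc i j hij x y hxy' hj
  · refine h.eq_of_isDegeneration hC hdeg hxy' (fun o ho => ?_) hv
    rcases hO o ho with hl | rfl
    · exact hxy'.2 o hl
    · exact hj

theorem vOut_le (h : IsGenieCode G U M f) (hG : IsGrounded G) : vOut G ≤ ∑ s, len s := by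
  classical
  -- Fixing all leaf messages to `false` makes any two inputs agree on leaves, so equal codewords
  -- give indistinguishable inputs.
  let e : ({i // ¬ IsLeaf G i} → Bool) → Fin n → Bool :=
    fun a i => if hi : ¬ IsLeaf G i then a ⟨i, hi⟩ else false
  have hinj : Function.Injective fun a s => f s (e a) := by
    intro a b hab
    have hxy : Indistinguishable G f (e a) (e b) :=
      ⟨fun s => congrFun hab s, fun l hl => by simp [e, hl]⟩
    funext ⟨i, hi⟩
    obtain ⟨l, hl, hil⟩ := isGrounded_iff.1 hG i
    simpa [e, hi] using h.eq_of_reflTransGen hxy hil (hxy.2 l hl)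
  have hcard := Fintype.card_le_of_injective _ hinj
  simp only [Fintype.card_pi, Fintype.card_bool, Finset.prod_const, Finset.card_univ,
    Fintype.card_fin, Finset.prod_pow_eq_pow_sum] at hcard
  have hle := (Nat.pow_le_pow_iff_right (by norm_num)).1 hcard
  rwa [← Nat.card_eq_fintype_card] at hle

end IsGenieCode

/-- The state has a genie code with codewords of lengths `len`. -/
def HasGenieCode (len : Fin S → ℕ) (A : State) : Prop :=
  ∃ (M : Fin S → Set (Fin A.n)) (f : ∀ s, (Fin A.n → Bool) → Fin (len s) → Bool),
    IsGenieCode A.G A.U M f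

theorem HasGenieCode.step {len : Fin S → ℕ} {A B : State} (h : HasGenieCode len A)
    (hAB : Step A B) : HasGenieCode len B := by
  obtain ⟨M, f, h⟩ := h
  cases hAB with
  | prune G U C hC hU v hv => exact ⟨M, f, h.pruneAt v⟩
  | appendDisconnected G U C hC hU v hv => exact ⟨_, _, h.appendDummy hC hU hv⟩
  | appendDegeneratedNonLeaf G U C I O hC hU hdeg v hv w hw hwl =>
    refine ⟨M, f, h.addArc hC hdeg hv fun o ho => or_iff_not_imp_left.2 fun hol => ?_⟩
    -- Any non-leaf vertex of `O` is `w`, by condition (b).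
    exact hdeg.nonLeaf_subsingleton ⟨ho, hol⟩ ⟨hw, hwl⟩
  | appendDegeneratedLeaf G U C I O hC hU hdeg hO v hv w hw =>
    exact ⟨M, f, h.addArc hC hdeg hv fun o ho => .inl (hO o ho)⟩

theorem HasGenieCode.reflTransGen {len : Fin S → ℕ} {A B : State} (h : HasGenieCode len A)
    (hAB : ReflTransGen Step A B) : HasGenieCode len B := by
  induction hAB with
  | refl => exact h
  | tail _ hbc ih => exact ih.step hbc

theorem IndexCode.hasGenieCode {n : ℕ} {G : Digraph (Fin n)} {M : Fin S → Set (Fin n)}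
    (c : IndexCode G M) : HasGenieCode c.len ⟨n, G, messageGraph M⟩ := by
  refine ⟨M, fun s x => c.enc s fun i => x i.1, fun s i hi j hj hij => ⟨hij, s, hi, hj⟩,
    fun s x y hxy => congrArg (c.enc s) (funext fun i => hxy i.1 i.2), ?_⟩
  intro i j hij x y hxy hj
  -- Under both inputs receiver `j` has the same codewords and the same own bit, so its decoder
  -- returns the same value for message `i`.
  have hx := congrFun (c.correct x j) ⟨i, hij⟩
  have hy := congrFun (c.correct y j) ⟨i, hij⟩
  rw [funext hxy.1, hj] at hx
  exact hx.symm.trans hy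

theorem IndexCode.vOut_le_codelength {n : ℕ} {G : Digraph (Fin n)} {M : Fin S → Set (Fin n)}
    (c : IndexCode G M) {T : State} (hT : IsResult ⟨n, G, messageGraph M⟩ T) :
    vOut T.G ≤ c.codelength := by
  obtain ⟨M', f, h⟩ := c.hasGenieCode.reflTransGen hT.1
  exact h.vOut_le hT.2

end LowerBound

end IndexCoding

theorem mainTheorem6 (n S : ℕ) (G : Digraph (Fin n)) (hG : ∀ i, ¬ G.Adj i i)
    (M : Fin S → Set (Fin n)) (hM : ∀ i, ∃ s, i ∈ M s) :
    ∃ m : ℕ,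
      IsGreatest {k | ∃ T : IndexCoding.State,
        IndexCoding.IsResult ⟨n, G, IndexCoding.messageGraph M⟩ T ∧
          IndexCoding.vOut T.G = k} m ∧
      m ≤ IndexCoding.optimalCodelength G M := by
  obtain ⟨c, hc⟩ := IndexCoding.exists_codelength_eq_optimal G M hM
  have hle : ∀ T, IndexCoding.IsResult ⟨n, G, IndexCoding.messageGraph M⟩ T →
      IndexCoding.vOut T.G ≤ IndexCoding.optimalCodelength G M :=
    fun T hT => hc ▸ c.vOut_le_codelength hT
  obtain ⟨T₀, hT₀⟩ := IndexCoding.exists_isResult ⟨n, G, IndexCoding.messageGraph M⟩ hG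
  let R : Set ℕ := {k | ∃ T : IndexCoding.State,
    IndexCoding.IsResult ⟨n, G, IndexCoding.messageGraph M⟩ T ∧ IndexCoding.vOut T.G = k}
  have hR : ∀ k ∈ R, k ≤ IndexCoding.optimalCodelength G M := by
    rintro _ ⟨T, hT, rfl⟩
    exact hle T hT
  -- A non-empty bounded set of naturals contains its supremum; non-emptiness is where termination
  -- enters.
  have hne : R.Nonempty := ⟨_, T₀, hT₀, rfl⟩
  have hmem : sSup R ∈ R := Nat.sSup_mem hne ⟨_, hR⟩
  exact ⟨sSup R, ⟨hmem, fun k hk => le_csSup ⟨_, hR⟩ hk⟩, hR _ hmem⟩
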